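/- Let $M$ be a connected, Hausdorff, paracompact smooth manifold of dimension $n$ (without boundary), let $\mu$ be a volume form on $M$ (a nowhere vanishing smooth $n$-form), and let $b$ be a geometric structure on $M$, i.e. a smooth non-degenerate $(0,2)$-tensor field (no symmetry is assumed). For $F\in\mathcal C^\infty(M,\mathbb R)$ let the left gradient $\nabla^L_bF$ and the right gradient $\nabla^R_bF$ be the vector fields uniquely defined by $b(\nabla^L_bF,X)=\mathrm dF\cdot X$ and $b(X,\nabla^R_bF)=\mathrm dF\cdot X$ for all vector fields $X$. For a smooth vector field $X$ let $\operatorname{div}_\mu X$ be the function uniquely defined by $\mathcal L_X\mu=(\operatorname{div}_\mu X)\,\mu$, where $\mathcal L_X$ is the Lie derivative, and put $\Delta^L_bF=\operatorname{div}_\mu(\nabla^L_bF)$ and $\Delta^R_bF=\operatorname{div}_\mu(\nabla^R_bF)$. Let $\{F,G\}_b=b(\nabla^L_bF,\nabla^L_bG)$, which also equals $b(\nabla^R_bF,\nabla^R_bG)$, and $\{F,G\}_{b,sym}=\tfrac12\left(\{F,G\}_b+\{G,F\}_b\right)$. Then, both for $\Delta_b=\Delta^L_b$ and for $\Delta_b=\Delta^R_b$: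 (i) for all $F,G\in\mathcal C^\infty(M,\mathbb R)$, $$\{F,G\}_{b,sym}=\tfrac12\left(\Delta_b(FG)-F\,\Delta_bG-G\,\Delta_bF\right);$$ (ii) for all $F\in\mathcal C^\infty(M,\mathbb R)$ and all $\phi\in\mathcal C^\infty(\mathbb R,\mathbb R)$, $$\Delta_b(\phi\circ F)=\phi'(F)\,\Delta_bF+\phi''(F)\,\{F,F\}_b.$$ -/

import Mathlib

open Set Bundle Module
open scoped Manifold ContDiff Topology

noncomputable section

namespace GeomLaplace

/-! ### Fields on a manifold

`M` is an `n`-dimensional smooth manifold without boundary, modelled on `ℝⁿ`. -/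

section Fields

variable {n : ℕ} {M : Type*} [TopologicalSpace M] [ChartedSpace (EuclideanSpace ℝ (Fin n)) M]

/-- The expression, in the chart at `x₀`, of a field `η` of alternating `k`-linear forms on the
tangent spaces of `M`: the pullback of `η` by the inverse of the chart. -/
def formInChart {k : ℕ} (η : ∀ x : M, TangentSpace (𝓡 n) x [⋀^Fin k]→L[ℝ] ℝ) (x₀ : M)
    (u : EuclideanSpace ℝ (Fin n)) : EuclideanSpace ℝ (Fin n) [⋀^Fin k]→L[ℝ] ℝ :=
  (η ((extChartAt (𝓡 n) x₀).symm u)).compContinuousLinearMap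
    (mfderivWithin 𝓘(ℝ, EuclideanSpace ℝ (Fin n)) (𝓡 n) (extChartAt (𝓡 n) x₀).symm
      (range (𝓡 n)) u)

/-- The expression, in the chart at `x₀`, of a vector field `X` on `M`. -/
def vectorFieldInChart (X : ∀ x : M, TangentSpace (𝓡 n) x) (x₀ : M)
    (u : EuclideanSpace ℝ (Fin n)) : EuclideanSpace ℝ (Fin n) :=
  VectorField.mpullbackWithin 𝓘(ℝ, EuclideanSpace ℝ (Fin n)) (𝓡 n)
    (extChartAt (𝓡 n) x₀).symm X (range (𝓡 n)) u

/-- A differential `k`-form is smooth if its expressions in the charts are smooth. -/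
def IsSmoothForm {k : ℕ} (η : ∀ x : M, TangentSpace (𝓡 n) x [⋀^Fin k]→L[ℝ] ℝ) : Prop :=
  ∀ x₀ : M, ContDiffOn ℝ ∞ (formInChart η x₀) (extChartAt (𝓡 n) x₀).target

end Fields

/-! ### The Lie derivative of a differential form -/

section LieDerivative

variable {E : Type*} [NormedAddCommGroup E] [NormedSpace ℝ E]

theorem sum_compContinuousLinearMap_apply {k : ℕ} (A : E →L[ℝ] E)
    (η : E [⋀^Fin k]→L[ℝ] ℝ) (v : Fin k → E) :
    (∑ i : Fin k, η.toContinuousMultilinearMap.compContinuousLinearMap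
      (Function.update (fun _ => ContinuousLinearMap.id ℝ E) i A)) v =
    ∑ i, η (Function.update v i (A (v i))) := by
  rw [sum_apply]
  refine Finset.sum_congr rfl fun i _ => ?_
  rw [ContinuousMultilinearMap.compContinuousLinearMap_apply]
  change η _ = η _
  congr 1
  ext1 j
  by_cases h : j = i
  · subst h; simp
  · simp [h]

/-- The action of an endomorphism `A` on alternating forms as a derivation:
`(v₁, …, vₖ) ↦ ∑ i, η (v₁, …, A vᵢ, …, vₖ)`. -/
def derivationAction {k : ℕ} (A : E →L[ℝ] E) (η : E [⋀^Fin k]→L[ℝ] ℝ) : E [⋀^Fin k]→L[ℝ] ℝ :=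
  { ∑ i : Fin k, η.toContinuousMultilinearMap.compContinuousLinearMap
      (Function.update (fun _ => ContinuousLinearMap.id ℝ E) i A) with
    map_eq_zero_of_eq' := by
      intro v i j hv hij
      refine (sum_compContinuousLinearMap_apply A η v).trans ?_
      rw [Fintype.sum_eq_add i j hij]
      · have h : Function.update v j (A (v j)) =
            Function.update v i (A (v i)) ∘ Equiv.swap i j := by
          ext1 l
          rcases eq_or_ne l i with rfl | hi
          · simp [hij, hij.symm, hv]
          rcases eq_or_ne l j with rfl | hj
          · simp [hv]
          · simp [hi, hj, Equiv.swap_apply_of_ne_of_ne hi hj]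
        rw [h, show η (Function.update v i (A (v i)) ∘ Equiv.swap i j) =
          -η (Function.update v i (A (v i))) from η.toAlternatingMap.map_swap _ hij]
        exact add_neg_cancel _
      · rintro l ⟨hi, hj⟩
        exact η.map_eq_zero_of_eq _ (by simp [hi.symm, hj.symm, hv]) hij }

theorem derivationAction_apply {k : ℕ} (A : E →L[ℝ] E) (η : E [⋀^Fin k]→L[ℝ] ℝ)
    (v : Fin k → E) :
    derivationAction A η v = ∑ i, η (Function.update v i (A (v i))) :=
  sum_compContinuousLinearMap_apply A η v

/-- The Lie derivative of the `k`-form `η` along the vector field `X` on a normed space: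
`(L_X η)(v₁, …, vₖ) = (D_X η)(v₁, …, vₖ) + ∑ i, η (v₁, …, DX vᵢ, …, vₖ)`. -/
def flatLieDerivative {k : ℕ} (X : E → E) (η : E → E [⋀^Fin k]→L[ℝ] ℝ) (u : E) :
    E [⋀^Fin k]→L[ℝ] ℝ :=
  fderiv ℝ η u (X u) + derivationAction (fderiv ℝ X u) (η u)

/-- The Lie derivative `L_X η` of a differential form `η` on a manifold along a vector field `X`,
computed at each point `x` in the chart at `x`. -/
def lieDerivative {n k : ℕ} {M : Type*} [TopologicalSpace M]
    [ChartedSpace (EuclideanSpace ℝ (Fin n)) M]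
    (X : ∀ x : M, TangentSpace (𝓡 n) x)
    (η : ∀ x : M, TangentSpace (𝓡 n) x [⋀^Fin k]→L[ℝ] ℝ) (x : M) :
    TangentSpace (𝓡 n) x [⋀^Fin k]→L[ℝ] ℝ :=
  (flatLieDerivative (vectorFieldInChart X x) (formInChart η x)
    (extChartAt (𝓡 n) x x)).compContinuousLinearMap
      (mfderiv (𝓡 n) 𝓘(ℝ, EuclideanSpace ℝ (Fin n)) (extChartAt (𝓡 n) x) x)

end LieDerivative

/-! ### Geometric structures and volume forms -/

section Structures

variable (n : ℕ) (M : Type*) [TopologicalSpace M] [ChartedSpace (EuclideanSpace ℝ (Fin n)) M]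
  [IsManifold (𝓡 n) ∞ M]

/-- A geometric structure: a smooth non-degenerate `(0,2)`-tensor field, with no symmetry
assumed. -/
structure GeometricStructure where
  /-- The bilinear form on each tangent space. -/
  form (x : M) : TangentSpace (𝓡 n) x →L[ℝ] TangentSpace (𝓡 n) x →L[ℝ] ℝ
  contMDiff : ContMDiff (𝓡 n) ((𝓡 n).prod 𝓘(ℝ, EuclideanSpace ℝ (Fin n) →L[ℝ]
      EuclideanSpace ℝ (Fin n) →L[ℝ] ℝ)) ∞
    (fun x ↦ TotalSpace.mk' (EuclideanSpace ℝ (Fin n) →L[ℝ] EuclideanSpace ℝ (Fin n) →L[ℝ] ℝ)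
      x (form x))
  nondegenerate (x : M) : (form x).toLinearMap₁₂.Nondegenerate

/-- A volume form: a smooth nowhere vanishing differential form of top degree. -/
structure VolumeForm where
  /-- The alternating form on each tangent space. -/
  form (x : M) : TangentSpace (𝓡 n) x [⋀^Fin n]→L[ℝ] ℝ
  smooth : IsSmoothForm form
  ne_zero (x : M) : form x ≠ 0

end Structures

section Operators

variable {n : ℕ} {M : Type*} [TopologicalSpace M] [ChartedSpace (EuclideanSpace ℝ (Fin n)) M]
  [IsManifold (𝓡 n) ∞ M]

instance finiteDimensional_tangentSpace (x : M) : FiniteDimensional ℝ (TangentSpace (𝓡 n) x) :=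
  inferInstanceAs (FiniteDimensional ℝ (EuclideanSpace ℝ (Fin n)))

theorem existsUnique_leftGradient (b : GeometricStructure n M) (F : M → ℝ) (x : M) :
    ∃! v : TangentSpace (𝓡 n) x, ∀ w, b.form x v w = mvfderiv (𝓡 n) F x w := by
  have hb : (b.form x).toBilinForm.Nondegenerate := b.nondegenerate x
  refine ⟨((b.form x).toBilinForm.toDual hb).symm (mvfderiv (𝓡 n) F x).toLinearMap,
    fun w => LinearMap.BilinForm.apply_toDual_symm_apply (hB := hb) _ w, fun v hv => ?_⟩
  rw [LinearEquiv.eq_symm_apply]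
  ext w
  exact hv w

theorem existsUnique_rightGradient (b : GeometricStructure n M) (F : M → ℝ) (x : M) :
    ∃! v : TangentSpace (𝓡 n) x, ∀ w, b.form x w v = mvfderiv (𝓡 n) F x w := by
  have hb : (LinearMap.BilinForm.flip (b.form x).toBilinForm).Nondegenerate :=
    ⟨(b.nondegenerate x).2, (b.nondegenerate x).1⟩
  refine ⟨((LinearMap.BilinForm.flip (b.form x).toBilinForm).toDual hb).symm (mvfderiv (𝓡 n) F x).toLinearMap,
    fun w => LinearMap.BilinForm.apply_toDual_symm_apply (hB := hb) _ w, fun v hv => ?_⟩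
  rw [LinearEquiv.eq_symm_apply]
  ext w
  exact hv w

/-- The left gradient: the unique vector field with `b (∇ᴸF, X) = dF (X)` for all `X`. -/
def leftGradient (b : GeometricStructure n M) (F : M → ℝ) (x : M) : TangentSpace (𝓡 n) x :=
  (existsUnique_leftGradient b F x).choose

/-- The right gradient: the unique vector field with `b (X, ∇ᴿF) = dF (X)` for all `X`. -/
def rightGradient (b : GeometricStructure n M) (F : M → ℝ) (x : M) : TangentSpace (𝓡 n) x :=
  (existsUnique_rightGradient b F x).choose

/-- The bracket `{F, G}_b = b (∇ᴸF, ∇ᴸG)`. -/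
def bracket (b : GeometricStructure n M) (F G : M → ℝ) (x : M) : ℝ :=
  b.form x (leftGradient b F x) (leftGradient b G x)

/-- The bracket is also given by the right gradients. -/
theorem bracket_eq_rightGradient (b : GeometricStructure n M) (F G : M → ℝ) (x : M) :
    bracket b F G x = b.form x (rightGradient b F x) (rightGradient b G x) := by
  have hl (H : M → ℝ) := (existsUnique_leftGradient b H x).choose_spec.1
  have hr (H : M → ℝ) := (existsUnique_rightGradient b H x).choose_spec.1
  unfold bracket leftGradient rightGradient
  rw [hl F, hr G, ← hr F, hl G]

/-- The symmetric bracket `{F, G}_{b,sym} = ½ ({F, G}_b + {G, F}_b)`. -/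
def symBracket (b : GeometricStructure n M) (F G : M → ℝ) (x : M) : ℝ :=
  (1 / 2) * (bracket b F G x + bracket b G F x)

theorem existsUnique_divergence (μ : VolumeForm n M) (X : ∀ x : M, TangentSpace (𝓡 n) x)
    (x : M) : ∃! c : ℝ, lieDerivative X μ.form x = c • μ.form x := by
  let e : Basis (Fin n) ℝ (TangentSpace (𝓡 n) x) :=
    (EuclideanSpace.basisFun (Fin n) ℝ).toBasis
  have he : μ.form x e ≠ 0 := by
    intro h
    refine μ.ne_zero x (ContinuousAlternatingMap.toAlternatingMap_injective ?_)
    rw [(μ.form x).toAlternatingMap.eq_smul_basis_det e]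
    change μ.form x e • _ = _
    rw [h, zero_smul]
    rfl
  refine ⟨lieDerivative X μ.form x e / μ.form x e, ?_, fun c hc => ?_⟩
  · apply ContinuousAlternatingMap.toAlternatingMap_injective
    rw [(lieDerivative X μ.form x).toAlternatingMap.eq_smul_basis_det e]
    ext v
    change lieDerivative X μ.form x e * e.det v =
      lieDerivative X μ.form x e / μ.form x e * (μ.form x).toAlternatingMap v
    rw [(μ.form x).toAlternatingMap.eq_smul_basis_det e]
    change _ = _ * (μ.form x e * e.det v)
    field_simp
  · rw [hc, ContinuousAlternatingMap.smul_apply, smul_eq_mul, mul_div_cancel_right₀ _ he]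

/-- The divergence: the unique function with `L_X μ = (div_μ X) μ`. -/
def divergence (μ : VolumeForm n M) (X : ∀ x : M, TangentSpace (𝓡 n) x) (x : M) : ℝ :=
  (existsUnique_divergence μ X x).choose

/-- The left Laplacian `Δᴸ = div_μ ∘ ∇ᴸ`. -/
def leftLaplacian (b : GeometricStructure n M) (μ : VolumeForm n M) (F : M → ℝ) : M → ℝ :=
  divergence μ (leftGradient b F)

/-- The right Laplacian `Δᴿ = div_μ ∘ ∇ᴿ`. -/
def rightLaplacian (b : GeometricStructure n M) (μ : VolumeForm n M) (F : M → ℝ) : M → ℝ :=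
  divergence μ (rightGradient b F)

end Operators

end GeomLaplace

end

/-! Both identities follow from two facts: a gradient depends linearly on the differential, hence
obeys the Leibniz and chain rules, and `div_μ (f X) = f div_μ X + df(X)` (`divergence_smul`). Thus
`Δ(FG) - F ΔG - G ΔF = dF(∇G) + dG(∇F)`, which is `{F,G}_b + {G,F}_b` for either gradient, and
`Δ(φ∘F) = div_μ (φ'(F) ∇F)` produces the extra term `φ''(F) dF(∇F)`. The product rule for the
divergence is linear algebra: `D(fX) = f DX + df ⊗ X`, and the rank one part acts on top-degree
forms by its trace `df(X)` (`derivationAction_smulRight`). It requires fields differentiable in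
charts; gradients are, because in a chart they solve a smooth invertible linear system
(`contDiffOn_of_forall_eq`). -/

namespace GeomLaplace

/-! ### Lie derivatives of top-degree forms and linear systems on a vector space -/

section Flat

variable {E : Type*} [NormedAddCommGroup E] [NormedSpace ℝ E]

theorem derivationAction_add {k : ℕ} (A B : E →L[ℝ] E) (η : E [⋀^Fin k]→L[ℝ] ℝ) :
    derivationAction (A + B) η = derivationAction A η + derivationAction B η := by
  ext v
  simp [derivationAction_apply, Finset.sum_add_distrib]

theorem derivationAction_smul {k : ℕ} (c : ℝ) (A : E →L[ℝ] E) (η : E [⋀^Fin k]→L[ℝ] ℝ) :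
    derivationAction (c • A) η = c • derivationAction A η := by
  ext v
  simp [derivationAction_apply, Finset.mul_sum]

/-- A rank one endomorphism acts on forms of top degree as multiplication by its trace. -/
theorem derivationAction_smulRight {n : ℕ} (e : Basis (Fin n) ℝ E) (φ : E →L[ℝ] ℝ) (v : E)
    (η : E [⋀^Fin n]→L[ℝ] ℝ) :
    derivationAction (φ.smulRight v) η = φ v • η := by
  apply ContinuousAlternatingMap.toAlternatingMap_injective
  refine Basis.ext_alternating e fun s hs => ?_
  have hbij : Function.Bijective s := Finite.injective_iff_bijective.mp hs
  let e' : Basis (Fin n) ℝ E := e.reindex (Equiv.ofBijective s hbij).symm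
  have he' : (fun i => e (s i)) = e' := by
    ext1 i
    simp [e']
  rw [he']
  change derivationAction (φ.smulRight v) η e' = φ v • η e'
  -- When `v` is expanded in the basis, every term but the `i`-th repeats a basis vector and is
  -- killed by alternation.
  have key (i : Fin n) : η (Function.update e' i v) = e'.repr v i * η e' := by
    conv_lhs => rw [← e'.sum_repr v]
    change η.toAlternatingMap (Function.update e' i _) = _
    rw [AlternatingMap.map_update_sum, Finset.sum_eq_single i]
    · rw [AlternatingMap.map_update_smul]
      simp
    · intro j _ hj
      rw [AlternatingMap.map_update_smul]
      rw [η.toAlternatingMap.map_update_self _ hj.symm, smul_zero]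
    · simp
  have hφ : φ v = ∑ i, e'.repr v i * φ (e' i) := by
    conv_lhs => rw [← e'.sum_repr v]
    simp only [map_sum, map_smul, smul_eq_mul]
  rw [derivationAction_apply, hφ, smul_eq_mul, Finset.sum_mul]
  refine Finset.sum_congr rfl fun i _ => ?_
  rw [ContinuousLinearMap.smulRight_apply, η.map_update_smul, key, smul_eq_mul]
  ring

theorem flatLieDerivative_add {k : ℕ} {X Y : E → E} {u : E} (hX : DifferentiableAt ℝ X u)
    (hY : DifferentiableAt ℝ Y u) (η : E → E [⋀^Fin k]→L[ℝ] ℝ) :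
    flatLieDerivative (fun w => X w + Y w) η u =
      flatLieDerivative X η u + flatLieDerivative Y η u := by
  unfold flatLieDerivative
  rw [fderiv_fun_add hX hY, derivationAction_add, map_add]
  abel

/-- The last term is the trace of the rank one part `df ⊗ X` of `D(fX)`. The basis `e` records that
the degree of the form equals the dimension. -/
theorem flatLieDerivative_smul {n : ℕ} (e : Basis (Fin n) ℝ E) {f : E → ℝ} {X : E → E} {u : E}
    (hf : DifferentiableAt ℝ f u) (hX : DifferentiableAt ℝ X u) (η : E → E [⋀^Fin n]→L[ℝ] ℝ) :
    flatLieDerivative (fun w => f w • X w) η u =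
      f u • flatLieDerivative X η u + fderiv ℝ f u (X u) • η u := by
  unfold flatLieDerivative
  rw [fderiv_fun_smul hf hX, derivationAction_add, derivationAction_smul,
    derivationAction_smulRight e, map_smul, smul_add, add_assoc]

/-- The solution `g` of a nondegenerate smooth linear system `β (g, ·) = α` is smooth. -/
theorem contDiffOn_of_forall_eq [FiniteDimensional ℝ E] {U : Set E} (hU : IsOpen U)
    {β : E → E →L[ℝ] E →L[ℝ] ℝ} {α : E → E →L[ℝ] ℝ} {g : E → E} {m : WithTop ℕ∞}
    (hβ : ContDiffOn ℝ m β U) (hα : ContDiffOn ℝ m α U)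
    (hinj : ∀ u ∈ U, ∀ v, β u v = 0 → v = 0) (hg : ∀ u ∈ U, β u (g u) = α u) :
    ContDiffOn ℝ m g U := by
  have : CompleteSpace E := FiniteDimensional.complete ℝ E
  have hinv (u : E) (hu : u ∈ U) : (β u).IsInvertible := by
    have h1 : Function.Injective (β u : E →ₗ[ℝ] E →L[ℝ] ℝ) :=
      (injective_iff_map_eq_zero _).mpr (hinj u hu)
    -- `E` and its dual have equal dimension, so injectivity already gives invertibility.
    have h2 : finrank ℝ E = finrank ℝ (E →L[ℝ] ℝ) := by
      rw [← (LinearMap.toContinuousLinearMap (𝕜 := ℝ) (E := E) (F' := ℝ)).finrank_eq]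
      exact (Subspace.dual_finrank_eq (K := ℝ) (V := E)).symm
    refine ⟨(LinearEquiv.ofInjectiveOfFinrankEq _ h1 h2).toContinuousLinearEquiv, ?_⟩
    ext v w
    rfl
  -- Here `g = β⁻¹ α`, and inversion of operators is smooth at invertible ones.
  have hs : ContDiffOn ℝ m (fun u => (β u).inverse (α u)) U := fun u hu =>
    (((hinv u hu).contDiffAt_map_inverse.comp u
      ((hβ u hu).contDiffAt (hU.mem_nhds hu))).clm_apply
        ((hα u hu).contDiffAt (hU.mem_nhds hu))).contDiffWithinAt
  refine hs.congr fun u hu => ?_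
  exact ((hinv u hu).inverse_apply_eq.mpr (hg u hu).symm).symm

theorem contDiffOn_flip [FiniteDimensional ℝ E] {U : Set E} {β : E → E →L[ℝ] E →L[ℝ] ℝ}
    {m : WithTop ℕ∞} (hβ : ContDiffOn ℝ m β U) : ContDiffOn ℝ m (fun u => (β u).flip) U :=
  contDiffOn_clm_apply.mpr fun v => contDiffOn_clm_apply.mpr fun _ =>
    contDiffOn_clm_apply.mp (contDiffOn_clm_apply.mp hβ _) v

end Flat

/-! ### Functions, vector fields and forms read in a chart -/

section Manifold

variable {n : ℕ} {M : Type*} [TopologicalSpace M] [ChartedSpace (EuclideanSpace ℝ (Fin n)) M]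

theorem vectorFieldInChart_add (X Y : ∀ x : M, TangentSpace (𝓡 n) x) (x₀ : M) :
    vectorFieldInChart (fun y => X y + Y y) x₀ =
      fun u => vectorFieldInChart X x₀ u + vectorFieldInChart Y x₀ u := by
  ext1 u
  exact map_add _ _ _

theorem vectorFieldInChart_smul (f : M → ℝ) (X : ∀ x : M, TangentSpace (𝓡 n) x) (x₀ : M) :
    vectorFieldInChart (fun y => f y • X y) x₀ =
      fun u => f ((extChartAt (𝓡 n) x₀).symm u) • vectorFieldInChart X x₀ u := by
  ext1 u
  exact map_smul _ _ _

theorem mvfderiv_fun_mul_apply {F G : M → ℝ} (hF : ContMDiff (𝓡 n) 𝓘(ℝ, ℝ) ∞ F)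
    (hG : ContMDiff (𝓡 n) 𝓘(ℝ, ℝ) ∞ G) (x : M) (w : TangentSpace (𝓡 n) x) :
    mvfderiv (𝓡 n) (fun y => F y * G y) x w =
      F x * mvfderiv (𝓡 n) G x w + G x * mvfderiv (𝓡 n) F x w := by
  have h := mvfderiv_mul ((hF x).mdifferentiableAt (by simp))
    ((hG x).mdifferentiableAt (by simp))
  exact congrArg (fun L : TangentSpace (𝓡 n) x →L[ℝ] ℝ => L w) h

theorem mvfderiv_comp_real_apply {F : M → ℝ} (hF : ContMDiff (𝓡 n) 𝓘(ℝ, ℝ) ∞ F) {φ : ℝ → ℝ}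
    (hφ : ContDiff ℝ ∞ φ) (x : M) (w : TangentSpace (𝓡 n) x) :
    mvfderiv (𝓡 n) (fun y => φ (F y)) x w = deriv φ (F x) * mvfderiv (𝓡 n) F x w := by
  have h := mfderiv_comp x (hφ.contMDiff.contMDiffAt.mdifferentiableAt (by simp))
    ((hF x).mdifferentiableAt (by simp))
  have h' : mvfderiv (𝓡 n) (fun y => φ (F y)) x w =
      fderiv ℝ φ (F x) (mvfderiv (𝓡 n) F x w) := by
    rw [← mfderiv_eq_fderiv]
    exact congrArg (fun L : EuclideanSpace ℝ (Fin n) →L[ℝ] ℝ => L w) h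
  rw [h', fderiv_eq_smul_deriv, smul_eq_mul, mul_comm]

variable [IsManifold (𝓡 n) ∞ M]

/-- The derivative of the inverse of the chart at `x₀`. -/
noncomputable def chartSymmDeriv (x₀ : M) (u : EuclideanSpace ℝ (Fin n)) :
    EuclideanSpace ℝ (Fin n) →L[ℝ] TangentSpace (𝓡 n) ((extChartAt (𝓡 n) x₀).symm u) :=
  mfderivWithin 𝓘(ℝ, EuclideanSpace ℝ (Fin n)) (𝓡 n) (extChartAt (𝓡 n) x₀).symm (range (𝓡 n)) u

theorem isInvertible_chartSymmDeriv {x₀ : M} {u : EuclideanSpace ℝ (Fin n)}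
    (hu : u ∈ (extChartAt (𝓡 n) x₀).target) : (chartSymmDeriv x₀ u).IsInvertible :=
  have : IsManifold (𝓡 n) 1 M := IsManifold.of_le (n := ∞) (by simp)
  isInvertible_mfderivWithin_extChartAt_symm hu

/-- The pullback uses `inverse`, which is zero off invertible maps; this is why `u` must lie in the
chart target. -/
theorem chartSymmDeriv_vectorFieldInChart (X : ∀ x : M, TangentSpace (𝓡 n) x) {x₀ : M}
    {u : EuclideanSpace ℝ (Fin n)} (hu : u ∈ (extChartAt (𝓡 n) x₀).target) :
    chartSymmDeriv x₀ u (vectorFieldInChart X x₀ u) = X ((extChartAt (𝓡 n) x₀).symm u) :=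
  (isInvertible_chartSymmDeriv hu).self_apply_inverse _

theorem contDiffOn_comp_chart_symm {F : M → ℝ} (hF : ContMDiff (𝓡 n) 𝓘(ℝ, ℝ) ∞ F) (x₀ : M) :
    ContDiffOn ℝ ∞ (fun u => F ((extChartAt (𝓡 n) x₀).symm u)) (extChartAt (𝓡 n) x₀).target :=
  contMDiffOn_iff_contDiffOn.mp (hF.comp_contMDiffOn (contMDiffOn_extChartAt_symm x₀))

theorem fderiv_comp_chart_symm {F : M → ℝ} (hF : ContMDiff (𝓡 n) 𝓘(ℝ, ℝ) ∞ F) {x₀ : M}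
    {u : EuclideanSpace ℝ (Fin n)} (hu : u ∈ (extChartAt (𝓡 n) x₀).target)
    (w : EuclideanSpace ℝ (Fin n)) :
    fderiv ℝ (fun u => F ((extChartAt (𝓡 n) x₀).symm u)) u w =
      mvfderiv (𝓡 n) F ((extChartAt (𝓡 n) x₀).symm u) (chartSymmDeriv x₀ u w) := by
  have hs : MDifferentiableAt 𝓘(ℝ, EuclideanSpace ℝ (Fin n)) (𝓡 n)
      (extChartAt (𝓡 n) x₀).symm u :=
    ((contMDiffOn_extChartAt_symm (n := ∞) x₀).contMDiffAt
      ((isOpen_extChartAt_target x₀).mem_nhds hu)).mdifferentiableAt (by simp)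
  have h := mfderiv_comp u ((hF _).mdifferentiableAt (by simp)) hs
  have hD : chartSymmDeriv x₀ u = mfderiv 𝓘(ℝ, EuclideanSpace ℝ (Fin n)) (𝓡 n)
      (extChartAt (𝓡 n) x₀).symm u := by
    unfold chartSymmDeriv
    rw [ModelWithCorners.range_eq_univ, mfderivWithin_univ]
  rw [hD, ← mfderiv_eq_fderiv]
  exact congrArg (fun L : EuclideanSpace ℝ (Fin n) →L[ℝ] ℝ => L w) h

theorem fderiv_comp_chart_symm_vectorFieldInChart {F : M → ℝ}
    (hF : ContMDiff (𝓡 n) 𝓘(ℝ, ℝ) ∞ F) (X : ∀ x : M, TangentSpace (𝓡 n) x) (x : M) :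
    fderiv ℝ (fun u => F ((extChartAt (𝓡 n) x).symm u)) (extChartAt (𝓡 n) x x)
      (vectorFieldInChart X x (extChartAt (𝓡 n) x x)) = mvfderiv (𝓡 n) F x (X x) := by
  rw [fderiv_comp_chart_symm hF (mem_extChartAt_target x),
    chartSymmDeriv_vectorFieldInChart X (mem_extChartAt_target x)]
  -- The base point occurs in the types, so it is moved in all places at once.
  exact congrArg (fun y : M => mvfderiv (𝓡 n) F y (X y)) (extChartAt_to_inv x)

/-- The derivatives of the chart and of its inverse cancel at the centre. -/
theorem formInChart_compContinuousLinearMap {k : ℕ}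
    (η : ∀ x : M, TangentSpace (𝓡 n) x [⋀^Fin k]→L[ℝ] ℝ) (x : M) :
    (formInChart η x (extChartAt (𝓡 n) x x)).compContinuousLinearMap
      (mfderiv (𝓡 n) 𝓘(ℝ, EuclideanSpace ℝ (Fin n)) (extChartAt (𝓡 n) x) x) = η x := by
  have : IsManifold (𝓡 n) 1 M := IsManifold.of_le (n := ∞) (by simp)
  ext w
  have hcomp := mfderivWithin_extChartAt_symm_comp_mfderiv_extChartAt' (I := 𝓡 n)
    (mem_extChartAt_source (I := 𝓡 n) x)
  have hw (i : Fin k) : mfderivWithin 𝓘(ℝ, EuclideanSpace ℝ (Fin n)) (𝓡 n)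
      (extChartAt (𝓡 n) x).symm (range (𝓡 n)) (extChartAt (𝓡 n) x x)
      (mfderiv (𝓡 n) 𝓘(ℝ, EuclideanSpace ℝ (Fin n)) (extChartAt (𝓡 n) x) x (w i)) = w i :=
    congrArg (fun L : TangentSpace (𝓡 n) x →L[ℝ] TangentSpace (𝓡 n) x => L (w i)) hcomp
  have h1 : (fun i => mfderivWithin 𝓘(ℝ, EuclideanSpace ℝ (Fin n)) (𝓡 n)
      (extChartAt (𝓡 n) x).symm (range (𝓡 n)) (extChartAt (𝓡 n) x x)
      (mfderiv (𝓡 n) 𝓘(ℝ, EuclideanSpace ℝ (Fin n)) (extChartAt (𝓡 n) x) x (w i))) = w :=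
    funext hw
  refine Eq.trans (congrArg (η ((extChartAt (𝓡 n) x).symm (extChartAt (𝓡 n) x x))) h1) ?_
  exact congrArg (fun y : M => (η y : (Fin k → EuclideanSpace ℝ (Fin n)) → ℝ) w)
    (extChartAt_to_inv x)

/-! ### The divergence as a derivation -/

theorem lieDerivative_eq_divergence_smul (μ : VolumeForm n M)
    (X : ∀ x : M, TangentSpace (𝓡 n) x) (x : M) :
    lieDerivative X μ.form x = divergence μ X x • μ.form x :=
  (existsUnique_divergence μ X x).choose_spec.1

theorem divergence_eq_of_lieDerivative_eq {μ : VolumeForm n M}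
    {X : ∀ x : M, TangentSpace (𝓡 n) x} {x : M} {c : ℝ}
    (h : lieDerivative X μ.form x = c • μ.form x) : divergence μ X x = c :=
  ((existsUnique_divergence μ X x).choose_spec.2 c h).symm

/-- Differentiability at `x` of a vector field, read in the chart at `x`. -/
def DifferentiableInChartAt (X : ∀ x : M, TangentSpace (𝓡 n) x) (x : M) : Prop :=
  DifferentiableAt ℝ (vectorFieldInChart X x) (extChartAt (𝓡 n) x x)

theorem divergence_add (μ : VolumeForm n M) {X Y : ∀ x : M, TangentSpace (𝓡 n) x} {x : M}
    (hX : DifferentiableInChartAt X x) (hY : DifferentiableInChartAt Y x) :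
    divergence μ (fun y => X y + Y y) x = divergence μ X x + divergence μ Y x := by
  apply divergence_eq_of_lieDerivative_eq
  rw [add_smul, ← lieDerivative_eq_divergence_smul, ← lieDerivative_eq_divergence_smul]
  unfold lieDerivative
  rw [vectorFieldInChart_add, flatLieDerivative_add hX hY]
  rfl

theorem divergence_smul (μ : VolumeForm n M) {f : M → ℝ} (hf : ContMDiff (𝓡 n) 𝓘(ℝ, ℝ) ∞ f)
    {X : ∀ x : M, TangentSpace (𝓡 n) x} {x : M} (hX : DifferentiableInChartAt X x) :
    divergence μ (fun y => f y • X y) x =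
      f x * divergence μ X x + mvfderiv (𝓡 n) f x (X x) := by
  apply divergence_eq_of_lieDerivative_eq
  have hf' : DifferentiableAt ℝ (fun u => f ((extChartAt (𝓡 n) x).symm u))
      (extChartAt (𝓡 n) x x) :=
    ((contDiffOn_comp_chart_symm hf x).contDiffAt
      (extChartAt_target_mem_nhds x)).differentiableAt (by simp)
  rw [add_smul, mul_smul, ← lieDerivative_eq_divergence_smul,
    ← fderiv_comp_chart_symm_vectorFieldInChart hf X x]
  -- Every term thereby becomes a pullback by the same chart derivative, and the flat product rule
  -- applies underneath.
  conv_rhs => rw [← formInChart_compContinuousLinearMap μ.form x]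
  unfold lieDerivative
  rw [vectorFieldInChart_smul,
    flatLieDerivative_smul (EuclideanSpace.basisFun (Fin n) ℝ).toBasis hf' hX,
    extChartAt_to_inv x]
  rfl

/-! ### Gradients -/

theorem form_leftGradient (b : GeometricStructure n M) (F : M → ℝ) (x : M)
    (w : TangentSpace (𝓡 n) x) :
    b.form x (leftGradient b F x) w = mvfderiv (𝓡 n) F x w :=
  (existsUnique_leftGradient b F x).choose_spec.1 w

theorem form_rightGradient (b : GeometricStructure n M) (F : M → ℝ) (x : M)
    (w : TangentSpace (𝓡 n) x) :
    b.form x w (rightGradient b F x) = mvfderiv (𝓡 n) F x w :=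
  (existsUnique_rightGradient b F x).choose_spec.1 w

theorem leftGradient_eq_of_forall {b : GeometricStructure n M} {F : M → ℝ} {x : M}
    {v : TangentSpace (𝓡 n) x} (h : ∀ w, b.form x v w = mvfderiv (𝓡 n) F x w) :
    leftGradient b F x = v :=
  ((existsUnique_leftGradient b F x).choose_spec.2 v h).symm

theorem rightGradient_eq_of_forall {b : GeometricStructure n M} {F : M → ℝ} {x : M}
    {v : TangentSpace (𝓡 n) x} (h : ∀ w, b.form x w v = mvfderiv (𝓡 n) F x w) :
    rightGradient b F x = v :=
  ((existsUnique_rightGradient b F x).choose_spec.2 v h).symm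

/-- The expression of a geometric structure in the chart at `x₀`. -/
noncomputable def bilinInChart (b : GeometricStructure n M) (x₀ : M) (u : EuclideanSpace ℝ (Fin n)) :
    EuclideanSpace ℝ (Fin n) →L[ℝ] EuclideanSpace ℝ (Fin n) →L[ℝ] ℝ :=
  let B : EuclideanSpace ℝ (Fin n) →L[ℝ] EuclideanSpace ℝ (Fin n) →L[ℝ] ℝ :=
    b.form ((extChartAt (𝓡 n) x₀).symm u)
  let D : EuclideanSpace ℝ (Fin n) →L[ℝ] EuclideanSpace ℝ (Fin n) := chartSymmDeriv x₀ u
  B.bilinearComp D D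

theorem bilinInChart_apply (b : GeometricStructure n M) (x₀ : M)
    (u v w : EuclideanSpace ℝ (Fin n)) :
    bilinInChart b x₀ u v w = b.form ((extChartAt (𝓡 n) x₀).symm u) (chartSymmDeriv x₀ u v)
      (chartSymmDeriv x₀ u w) :=
  rfl

/-- This is the tangent map of the inverse chart composed with the constant section `v`. -/
theorem contMDiffOn_chartSymmDeriv_apply (x₀ : M) (v : EuclideanSpace ℝ (Fin n)) :
    ContMDiffOn 𝓘(ℝ, EuclideanSpace ℝ (Fin n)) ((𝓡 n).prod 𝓘(ℝ, EuclideanSpace ℝ (Fin n))) ∞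
      (fun u => TotalSpace.mk' (EuclideanSpace ℝ (Fin n))
        (E := fun x : M => TangentSpace (𝓡 n) x) ((extChartAt (𝓡 n) x₀).symm u)
        (chartSymmDeriv x₀ u v)) (extChartAt (𝓡 n) x₀).target := by
  have h := (contMDiffOn_extChartAt_symm (I := 𝓡 n) (n := ∞) x₀).contMDiffOn_tangentMapWithin
    (m := ∞) (by simp) (isOpen_extChartAt_target x₀).uniqueMDiffOn
  have hv : ContMDiff 𝓘(ℝ, EuclideanSpace ℝ (Fin n)) (𝓘(ℝ, EuclideanSpace ℝ (Fin n)).prod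
      𝓘(ℝ, EuclideanSpace ℝ (Fin n))) ∞ (fun u => TotalSpace.mk' (EuclideanSpace ℝ (Fin n))
        (E := fun x : EuclideanSpace ℝ (Fin n) =>
          TangentSpace 𝓘(ℝ, EuclideanSpace ℝ (Fin n)) x) u v) :=
    contMDiff_vectorSpace_iff_contDiff.mpr contDiff_const
  refine (h.comp hv.contMDiffOn fun u hu => hu).congr fun u hu => ?_
  have hD : chartSymmDeriv x₀ u = mfderivWithin 𝓘(ℝ, EuclideanSpace ℝ (Fin n)) (𝓡 n)
      (extChartAt (𝓡 n) x₀).symm (extChartAt (𝓡 n) x₀).target u := by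
    unfold chartSymmDeriv
    rw [ModelWithCorners.range_eq_univ, mfderivWithin_univ,
      mfderivWithin_of_isOpen (isOpen_extChartAt_target x₀) hu]
  rw [hD]
  rfl

/-- In finite dimension smoothness can be tested on fixed vectors `v`, `w`, whose images are smooth
sections along the inverse chart. -/
theorem contDiffOn_bilinInChart (b : GeometricStructure n M) (x₀ : M) :
    ContDiffOn ℝ ∞ (bilinInChart b x₀) (extChartAt (𝓡 n) x₀).target := by
  refine contDiffOn_clm_apply.mpr fun v => contDiffOn_clm_apply.mpr fun w => ?_
  have hb := b.contMDiff.comp_contMDiffOn (contMDiffOn_extChartAt_symm (n := ∞) x₀)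
  have h := (hb.clm_bundle_apply (contMDiffOn_chartSymmDeriv_apply x₀ v)).clm_bundle_apply
    (F₂ := ℝ) (E₂ := fun _ : M => ℝ) (contMDiffOn_chartSymmDeriv_apply x₀ w)
  intro u hu
  have h' := h u hu
  rw [contMDiffWithinAt_totalSpace] at h'
  exact contMDiffWithinAt_iff_contDiffWithinAt.mp h'.2

/-- In the chart the gradient solves `β(g, ·) = d(F ∘ chart⁻¹)`, with `β` the expression of `b`. -/
theorem differentiableInChartAt_leftGradient (b : GeometricStructure n M) {F : M → ℝ}
    (hF : ContMDiff (𝓡 n) 𝓘(ℝ, ℝ) ∞ F) (x : M) :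
    DifferentiableInChartAt (leftGradient b F) x := by
  have hU := isOpen_extChartAt_target (I := 𝓡 n) x
  have h : ContDiffOn ℝ ∞ (vectorFieldInChart (leftGradient b F) x)
      (extChartAt (𝓡 n) x).target := by
    refine contDiffOn_of_forall_eq hU (contDiffOn_bilinInChart b x)
      ((contDiffOn_comp_chart_symm hF x).fderiv_of_isOpen hU (by simp)) ?_ ?_
    · intro u hu v hv
      have hD := isInvertible_chartSymmDeriv hu
      refine hD.injective ?_
      rw [map_zero]
      refine (b.nondegenerate _).1 _ fun w => ?_
      obtain ⟨w, rfl⟩ := hD.surjective w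
      exact congrArg (fun L : EuclideanSpace ℝ (Fin n) →L[ℝ] ℝ => L w) hv
    · intro u hu
      ext w
      rw [bilinInChart_apply, chartSymmDeriv_vectorFieldInChart _ hu, form_leftGradient,
        fderiv_comp_chart_symm hF hu]
  exact (h.contDiffAt (extChartAt_target_mem_nhds x)).differentiableAt (by simp)

theorem differentiableInChartAt_rightGradient (b : GeometricStructure n M) {F : M → ℝ}
    (hF : ContMDiff (𝓡 n) 𝓘(ℝ, ℝ) ∞ F) (x : M) :
    DifferentiableInChartAt (rightGradient b F) x := by
  have hU := isOpen_extChartAt_target (I := 𝓡 n) x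
  have hflip : ContDiffOn ℝ ∞ (fun u => (bilinInChart b x u).flip)
      (extChartAt (𝓡 n) x).target :=
    contDiffOn_flip (contDiffOn_bilinInChart b x)
  have h : ContDiffOn ℝ ∞ (vectorFieldInChart (rightGradient b F) x)
      (extChartAt (𝓡 n) x).target := by
    refine contDiffOn_of_forall_eq hU hflip
      ((contDiffOn_comp_chart_symm hF x).fderiv_of_isOpen hU (by simp)) ?_ ?_
    · intro u hu v hv
      have hD := isInvertible_chartSymmDeriv hu
      refine hD.injective ?_
      rw [map_zero]
      -- The flipped system needs nondegeneracy in the second slot.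
      refine (b.nondegenerate _).2 _ fun w => ?_
      obtain ⟨w, rfl⟩ := hD.surjective w
      exact congrArg (fun L : EuclideanSpace ℝ (Fin n) →L[ℝ] ℝ => L w) hv
    · intro u hu
      ext w
      rw [ContinuousLinearMap.flip_apply, bilinInChart_apply,
        chartSymmDeriv_vectorFieldInChart _ hu, form_rightGradient, fderiv_comp_chart_symm hF hu]
  exact (h.contDiffAt (extChartAt_target_mem_nhds x)).differentiableAt (by simp)

theorem bracket_eq_mvfderiv_leftGradient (b : GeometricStructure n M) (F G : M → ℝ) (x : M) :
    bracket b F G x = mvfderiv (𝓡 n) F x (leftGradient b G x) :=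
  form_leftGradient b F x _

/-- Compared with the left gradient, `F` and `G` exchange roles; the symmetrisation in (i) and the
choice `F = G` in (ii) make this harmless. -/
theorem bracket_eq_mvfderiv_rightGradient (b : GeometricStructure n M) (F G : M → ℝ) (x : M) :
    bracket b F G x = mvfderiv (𝓡 n) G x (rightGradient b F x) :=
  (bracket_eq_rightGradient b F G x).trans (form_rightGradient b G x _)

/-! ### Leibniz and chain rules for the gradients -/

theorem leftGradient_mul (b : GeometricStructure n M) {F G : M → ℝ}
    (hF : ContMDiff (𝓡 n) 𝓘(ℝ, ℝ) ∞ F) (hG : ContMDiff (𝓡 n) 𝓘(ℝ, ℝ) ∞ G) :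
    leftGradient b (fun y => F y * G y) =
      fun y => F y • leftGradient b G y + G y • leftGradient b F y := by
  ext1 y
  refine leftGradient_eq_of_forall fun w => ?_
  rw [mvfderiv_fun_mul_apply hF hG, ← form_leftGradient b F, ← form_leftGradient b G]
  simp

theorem rightGradient_mul (b : GeometricStructure n M) {F G : M → ℝ}
    (hF : ContMDiff (𝓡 n) 𝓘(ℝ, ℝ) ∞ F) (hG : ContMDiff (𝓡 n) 𝓘(ℝ, ℝ) ∞ G) :
    rightGradient b (fun y => F y * G y) =
      fun y => F y • rightGradient b G y + G y • rightGradient b F y := by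
  ext1 y
  refine rightGradient_eq_of_forall fun w => ?_
  rw [mvfderiv_fun_mul_apply hF hG, ← form_rightGradient b F, ← form_rightGradient b G]
  simp

theorem leftGradient_comp (b : GeometricStructure n M) {F : M → ℝ}
    (hF : ContMDiff (𝓡 n) 𝓘(ℝ, ℝ) ∞ F) {φ : ℝ → ℝ} (hφ : ContDiff ℝ ∞ φ) :
    leftGradient b (fun y => φ (F y)) = fun y => deriv φ (F y) • leftGradient b F y := by
  ext1 y
  refine leftGradient_eq_of_forall fun w => ?_
  rw [mvfderiv_comp_real_apply hF hφ, ← form_leftGradient b F]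
  simp

theorem rightGradient_comp (b : GeometricStructure n M) {F : M → ℝ}
    (hF : ContMDiff (𝓡 n) 𝓘(ℝ, ℝ) ∞ F) {φ : ℝ → ℝ} (hφ : ContDiff ℝ ∞ φ) :
    rightGradient b (fun y => φ (F y)) = fun y => deriv φ (F y) • rightGradient b F y := by
  ext1 y
  refine rightGradient_eq_of_forall fun w => ?_
  rw [mvfderiv_comp_real_apply hF hφ, ← form_rightGradient b F]
  simp

/-! ### Divergence of the combinations produced by those rules -/

theorem DifferentiableInChartAt.smul {f : M → ℝ} (hf : ContMDiff (𝓡 n) 𝓘(ℝ, ℝ) ∞ f)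
    {X : ∀ x : M, TangentSpace (𝓡 n) x} {x : M} (hX : DifferentiableInChartAt X x) :
    DifferentiableInChartAt (fun y => f y • X y) x := by
  unfold DifferentiableInChartAt
  rw [vectorFieldInChart_smul]
  exact (((contDiffOn_comp_chart_symm hf x).contDiffAt
    (extChartAt_target_mem_nhds x)).differentiableAt (by simp)).smul hX

/-- The product rule for the divergence of `F Y + G X`. -/
theorem divergence_smul_add_smul (μ : VolumeForm n M) {F G : M → ℝ}
    (hF : ContMDiff (𝓡 n) 𝓘(ℝ, ℝ) ∞ F) (hG : ContMDiff (𝓡 n) 𝓘(ℝ, ℝ) ∞ G)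
    {X Y : ∀ x : M, TangentSpace (𝓡 n) x} {x : M} (hX : DifferentiableInChartAt X x)
    (hY : DifferentiableInChartAt Y x) :
    divergence μ (fun y => F y • Y y + G y • X y) x =
      F x * divergence μ Y x + mvfderiv (𝓡 n) F x (Y x) +
        (G x * divergence μ X x + mvfderiv (𝓡 n) G x (X x)) := by
  rw [divergence_add μ (hY.smul hF) (hX.smul hG), divergence_smul μ hF hY,
    divergence_smul μ hG hX]

theorem divergence_deriv_smul (μ : VolumeForm n M) {F : M → ℝ}
    (hF : ContMDiff (𝓡 n) 𝓘(ℝ, ℝ) ∞ F) {φ : ℝ → ℝ} (hφ : ContDiff ℝ ∞ φ)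
    {X : ∀ x : M, TangentSpace (𝓡 n) x} {x : M} (hX : DifferentiableInChartAt X x) :
    divergence μ (fun y => deriv φ (F y) • X y) x = deriv φ (F x) * divergence μ X x +
      iteratedDeriv 2 φ (F x) * mvfderiv (𝓡 n) F x (X x) := by
  have hφ' : ContDiff ℝ ∞ (deriv φ) := (contDiff_infty_iff_deriv.mp hφ).2
  have hf : ContMDiff (𝓡 n) 𝓘(ℝ, ℝ) ∞ (fun y => deriv φ (F y)) := hφ'.comp_contMDiff hF
  rw [divergence_smul μ hf hX, mvfderiv_comp_real_apply hF hφ',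
    iteratedDeriv_succ, iteratedDeriv_one]

end Manifold

end GeomLaplace

/-! ### The two identities for both Laplacians -/

theorem theorem4p6 {n : ℕ} {M : Type*} [TopologicalSpace M]
    [ChartedSpace (EuclideanSpace ℝ (Fin n)) M] [IsManifold (𝓡 n) ∞ M]
    [T2Space M] [ParacompactSpace M] [ConnectedSpace M]
    (b : GeomLaplace.GeometricStructure n M) (μ : GeomLaplace.VolumeForm n M) :
    (∀ F G : M → ℝ, ContMDiff (𝓡 n) 𝓘(ℝ, ℝ) ∞ F → ContMDiff (𝓡 n) 𝓘(ℝ, ℝ) ∞ G → ∀ x : M,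
      GeomLaplace.symBracket b F G x =
          (1 / 2) * (GeomLaplace.leftLaplacian b μ (fun y => F y * G y) x
            - F x * GeomLaplace.leftLaplacian b μ G x
            - G x * GeomLaplace.leftLaplacian b μ F x) ∧
      GeomLaplace.symBracket b F G x =
          (1 / 2) * (GeomLaplace.rightLaplacian b μ (fun y => F y * G y) x
            - F x * GeomLaplace.rightLaplacian b μ G x
            - G x * GeomLaplace.rightLaplacian b μ F x)) ∧
    (∀ F : M → ℝ, ContMDiff (𝓡 n) 𝓘(ℝ, ℝ) ∞ F → ∀ φ : ℝ → ℝ, ContDiff ℝ ∞ φ → ∀ x : M,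
      GeomLaplace.leftLaplacian b μ (fun y => φ (F y)) x =
          deriv φ (F x) * GeomLaplace.leftLaplacian b μ F x
            + iteratedDeriv 2 φ (F x) * GeomLaplace.bracket b F F x ∧
      GeomLaplace.rightLaplacian b μ (fun y => φ (F y)) x =
          deriv φ (F x) * GeomLaplace.rightLaplacian b μ F x
            + iteratedDeriv 2 φ (F x) * GeomLaplace.bracket b F F x) := by
  refine ⟨fun F G hF hG x => ⟨?_, ?_⟩, fun F hF φ hφ x => ⟨?_, ?_⟩⟩
  · unfold GeomLaplace.symBracket GeomLaplace.leftLaplacian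
    rw [GeomLaplace.leftGradient_mul b hF hG, GeomLaplace.divergence_smul_add_smul μ hF hG
      (GeomLaplace.differentiableInChartAt_leftGradient b hF x)
      (GeomLaplace.differentiableInChartAt_leftGradient b hG x),
      ← GeomLaplace.bracket_eq_mvfderiv_leftGradient,
      ← GeomLaplace.bracket_eq_mvfderiv_leftGradient]
    ring
  · unfold GeomLaplace.symBracket GeomLaplace.rightLaplacian
    rw [GeomLaplace.rightGradient_mul b hF hG, GeomLaplace.divergence_smul_add_smul μ hF hG
      (GeomLaplace.differentiableInChartAt_rightGradient b hF x)
      (GeomLaplace.differentiableInChartAt_rightGradient b hG x),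
      ← GeomLaplace.bracket_eq_mvfderiv_rightGradient,
      ← GeomLaplace.bracket_eq_mvfderiv_rightGradient]
    -- The two brackets appear in the opposite order from the left case.
    ring
  · unfold GeomLaplace.leftLaplacian
    rw [GeomLaplace.leftGradient_comp b hF hφ, GeomLaplace.divergence_deriv_smul μ hF hφ
      (GeomLaplace.differentiableInChartAt_leftGradient b hF x),
      ← GeomLaplace.bracket_eq_mvfderiv_leftGradient]
  · unfold GeomLaplace.rightLaplacian
    rw [GeomLaplace.rightGradient_comp b hF hφ, GeomLaplace.divergence_deriv_smul μ hF hφ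
      (GeomLaplace.differentiableInChartAt_rightGradient b hF x),
      ← GeomLaplace.bracket_eq_mvfderiv_rightGradient]
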